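/- Let $\mathbb{S}^3=\{x\in\mathbb{R}^4 : \langle x,x\rangle=1\}$ with the round metric induced from $\mathbb{R}^4$. A \emph{surface in} $\mathbb{S}^3$ is a regular (smooth, embedded), connected surface $S\subset\mathbb{S}^3$, oriented by the choice of a smooth unit normal field $N$ tangent to $\mathbb{S}^3$ and orthogonal to $S$. Its principal curvatures $\lambda_1(p)\le\lambda_2(p)$ at $p\in S$ are the eigenvalues of the shape operator $v\mapsto -dN_p(v)$ of $T_pS$, and its Gaussian curvature is $K=1+\lambda_1\lambda_2$. An \emph{isometry} of $\mathbb{S}^3$ is a smooth diffeomorphism $f:\mathbb{S}^3\to\mathbb{S}^3$ with $\langle df_p X,df_p Y\rangle=\langle X,Y\rangle$ for all $p\in\mathbb{S}^3$ and $X,Y\in T_p\mathbb{S}^3$. \textbf{Theorem.} Let $S$ and $\tilde S$ be two surfaces in $\mathbb{S}^3$, with unit normals $N,\tilde N$, Gaussian curvatures $K,\tilde K$ and principal curvatures $\lambda_1\le\lambda_2$, $\tilde\lambda_1\le\tilde\lambda_2$. Let $f:\mathbb{S}^3\to\mathbb{S}^3$ be an isometry such that $f(S)\subset\tilde S$. Then: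 (i) $K(p)=\tilde K(f(p))$ for all $p\in S$. (ii) Either $df_p(N(p))=\tilde N(f(p))$ for all $p\in S$, or $df_p(N(p))=-\tilde N(f(p))$ for all $p\in S$. In the first case (the orientations of $S$ and $\tilde S$ correspond under $f$), $\lambda_1(p)=\tilde\lambda_1(f(p))$ and $\lambda_2(p)=\tilde\lambda_2(f(p))$ for all $p\in S$. In the second case (the orientations are opposite, so that the principal curvatures of $\tilde S$ with respect to $-\tilde N$ are $-\tilde\lambda_2\le-\tilde\lambda_1$), $\lambda_1(p)=-\tilde\lambda_2(f(p))$ and $\lambda_2(p)=-\tilde\lambda_1(f(p))$ for all $p\in S$. -/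

import Mathlib

open Set Metric
open scoped Manifold ContDiff RealInnerProductSpace

/-- The Euclidean plane. -/
abbrev E2 : Type := EuclideanSpace ℝ (Fin 2)

/-- Euclidean four-space. -/
abbrev E4 : Type := EuclideanSpace ℝ (Fin 4)

instance factFinrankE4 : Fact (Module.finrank ℝ E4 = 3 + 1) := ⟨by simp⟩

/-- The unit sphere of `ℝ⁴`, with Mathlib's structure of a smooth 3-manifold. -/
abbrev S3 : Type := sphere (0 : E4) 1

/-- The differential of the inclusion of the 3-sphere in `ℝ⁴`; it identifies the abstract tangent
space at `p` with the hyperplane orthogonal to `p`. -/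
noncomputable def inclDeriv (p : S3) : TangentSpace (𝓡 3) p →L[ℝ] E4 :=
  mfderiv (𝓡 3) 𝓘(ℝ, E4) (fun x : S3 => (x : E4)) p

/-- The round metric of the 3-sphere, induced from `ℝ⁴`. -/
noncomputable def roundMetric (p : S3) (X Y : TangentSpace (𝓡 3) p) : ℝ :=
  ⟪inclDeriv p X, inclDeriv p Y⟫

/-- A diffeomorphism of the 3-sphere is an isometry when its differential preserves the
round metric. -/
def IsSphereIsometry (f : S3 ≃ₘ⟮𝓡 3, 𝓡 3⟯ S3) : Prop :=
  ∀ (p : S3) (X Y : TangentSpace (𝓡 3) p),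
    roundMetric (f p) (mfderiv (𝓡 3) (𝓡 3) f p X) (mfderiv (𝓡 3) (𝓡 3) f p Y)
      = roundMetric p X Y

/-- A regular (embedded, smooth) surface in `ℝ⁴`: every point has an open neighbourhood `V` such
that `S ∩ V` is the image of a smooth local parametrization `x : U → ℝ⁴` which has injective
differential and is a homeomorphism onto its image (with continuous inverse `y`). -/
def IsRegularSurface (S : Set E4) : Prop :=
  ∀ p ∈ S, ∃ (V : Set E4) (U : Set E2) (x : E2 → E4) (y : E4 → E2),
    IsOpen V ∧ p ∈ V ∧ IsOpen U ∧ ContDiffOn ℝ ∞ x U ∧ x '' U = S ∩ V ∧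
    (∀ u ∈ U, Function.Injective (fderiv ℝ x u)) ∧
    ContinuousOn y (S ∩ V) ∧ (∀ u ∈ U, y (x u) = u)

/-- The tangent plane of `S` at `p`: the space of the velocities at `p` of the smooth curves
that lie in `S`. -/
def tangentPlane (S : Set E4) (p : E4) : Submodule ℝ E4 :=
  Submodule.span ℝ {v | ∃ γ : ℝ → E4, ContDiffAt ℝ ∞ γ 0 ∧ γ 0 = p ∧
    (∀ᶠ t in nhds (0 : ℝ), γ t ∈ S) ∧ deriv γ 0 = v}

/-- A regular, connected, oriented surface in the 3-sphere. Since the 3-sphere is oriented, an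
orientation of the surface is the choice of a smooth unit normal field, tangent to the sphere.
Only the values of `normal` on the surface matter. -/
structure OrientedSurface where
  carrier : Set E4
  subset_sphere : carrier ⊆ sphere (0 : E4) 1
  regular : IsRegularSurface carrier
  connected : IsConnected carrier
  normal : E4 → E4
  normal_smooth : ContDiffOn ℝ ∞ normal carrier
  normal_unit : ∀ p ∈ carrier, ‖normal p‖ = 1
  normal_tangent_sphere : ∀ p ∈ carrier, ⟪normal p, p⟫ = 0
  normal_perp : ∀ p ∈ carrier, ∀ v ∈ tangentPlane carrier p, ⟪normal p, v⟫ = 0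

namespace OrientedSurface

/-- The shape operator `v ↦ -(dN v)ᵀ` of the surface at `p`, an endomorphism of the tangent plane;
its associated bilinear form is the second fundamental form. The differential of the normal field
`N` is determined on tangent vectors by the values of `N` on the surface. -/
noncomputable def shapeOperator (S : OrientedSurface) (p : E4) :
    tangentPlane S.carrier p →ₗ[ℝ] tangentPlane S.carrier p :=
  -((tangentPlane S.carrier p).orthogonalProjectionOnto.toLinearMap ∘ₗ
    (fderivWithin ℝ S.normal S.carrier p).toLinearMap ∘ₗ (tangentPlane S.carrier p).subtype)

/-- The smaller principal curvature: the least eigenvalue of the shape operator (which is a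
symmetric operator on a plane). -/
noncomputable def lambda1 (S : OrientedSurface) (p : E4) : ℝ :=
  sInf {l : ℝ | Module.End.HasEigenvalue (S.shapeOperator p) l}

/-- The larger principal curvature: the greatest eigenvalue of the shape operator. -/
noncomputable def lambda2 (S : OrientedSurface) (p : E4) : ℝ :=
  sSup {l : ℝ | Module.End.HasEigenvalue (S.shapeOperator p) l}

/-- The Gaussian curvature `K = 1 + λ₁ λ₂` of a surface in the 3-sphere. -/
noncomputable def gaussCurvature (S : OrientedSurface) (p : E4) : ℝ :=
  1 + S.lambda1 p * S.lambda2 p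

end OrientedSurface

/-- `df` carries the unit normal of `S` at `p` to `ε` times the unit normal of `T` at `f p`, for
every `p` in `S`. -/
def CarriesNormal (f : S3 ≃ₘ⟮𝓡 3, 𝓡 3⟯ S3) (S T : OrientedSurface) (ε : ℝ) : Prop :=
  ∀ p : S3, (p : E4) ∈ S.carrier → ∀ X : TangentSpace (𝓡 3) p, inclDeriv p X = S.normal p →
    inclDeriv (f p) (mfderiv (𝓡 3) (𝓡 3) f p X) = ε • T.normal (f p)

/-! An isometry `f` of the sphere is the restriction of a linear isometry `A` of `ℝ⁴`. Its
homogeneous extension `x ↦ ‖x‖ f(x/‖x‖)` preserves norms and has isometric differential off `0`, so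
it is 1-Lipschitz; the same holds for the inverse, and Mazur–Ulam makes it linear
(`IsSphereIsometry.exists_linearIsometryEquiv`). Linearity reduces the rest to algebra. `A` maps
tangent planes onto tangent planes by a dimension count, hence normal spaces into normal spaces, so
`A N = ±Ñ ∘ A`, with a constant sign by connectedness (`map_normal_eq_or_eq_neg`). Differentiating
this along curves in `S` shows that `A` conjugates the shape operators up to that sign
(`shapeOperator_map`). The spectra therefore agree or are opposite, and `λ₁λ₂` is the same either
way. -/

/-! ### Smooth maps into the sphere and radial projection. -/

/-- A map into the 3-sphere is smooth at a point if it is smooth there as a map into `ℝ⁴`. -/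
theorem contMDiffAt_S3_of_coe {E : Type*} [NormedAddCommGroup E] [NormedSpace ℝ E]
    {ψ : E → S3} {x : E} (h : ContDiffAt ℝ ∞ (fun y => (ψ y : E4)) x) :
    ContMDiffAt 𝓘(ℝ, E) (𝓡 3) ∞ ψ x := by
  rw [contMDiffAt_iff_target]
  refine ⟨?_, ?_⟩
  · rw [Topology.IsInducing.subtypeVal.continuousAt_iff]
    exact h.continuousAt
  · set v : S3 := ψ x with hv
    let U : _ ≃ₗᵢ[ℝ] _ :=
      (OrthonormalBasis.fromOrthogonalSpanSingleton (𝕜 := ℝ)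
          3 (ne_zero_of_mem_unit_sphere (-v))).repr
    -- The chart at `v` is stereographic projection from `-v`, singular only where `⟪-v, ·⟫ = 1`; at
    -- `v` this product is `-1`.
    have hst : ContDiffAt ℝ ∞ (stereoToFun ((-v : S3) : E4)) (ψ x) := by
      refine (contDiffOn_stereoToFun.contDiffAt (IsOpen.mem_nhds ?_ ?_)).of_le le_top
      · exact isOpen_ne.preimage (innerSL ℝ ((-v : S3) : E4)).continuous
      · have : ⟪(v : E4), (v : E4)⟫ = 1 := by simp
        simp only [mem_ofPred_eq, innerSL_apply_apply, coe_neg_sphere, inner_neg_left, ← hv, this]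
        norm_num
    have h1 : ContDiffAt ℝ ∞ (stereoToFun ((-v : S3) : E4) ∘ fun y => (ψ y : E4)) x :=
      hst.comp x h
    have h2 : ContDiffAt ℝ ∞ (U ∘ stereoToFun ((-v : S3) : E4) ∘ fun y => (ψ y : E4)) x :=
      U.contDiff.contDiffAt.comp x h1
    exact h2.contMDiffAt

/-- The radial projection of `ℝ⁴ ∖ {0}` onto the 3-sphere (with an arbitrary value at `0`). -/
noncomputable def radial (x : E4) : S3 :=
  if h : x = 0 then ⟨EuclideanSpace.single 0 1, by simp⟩
  else ⟨‖x‖⁻¹ • x, by simp [norm_smul, h]⟩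

theorem coe_radial {x : E4} (h : x ≠ 0) : (radial x : E4) = ‖x‖⁻¹ • x := by
  simp [radial, h]

theorem norm_smul_radial (x : E4) : ‖x‖ • (radial x : E4) = x := by
  by_cases h : x = 0
  · simp [h]
  · rw [coe_radial h, smul_inv_smul₀ (norm_ne_zero_iff.2 h)]

theorem radial_smul {r : ℝ} (hr : 0 < r) (p : S3) : radial (r • (p : E4)) = p := by
  have hp : ‖(p : E4)‖ = 1 := by simp
  have h0 : r • (p : E4) ≠ 0 := smul_ne_zero hr.ne' (norm_ne_zero_iff.1 (by simp))
  ext1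
  rw [coe_radial h0, norm_smul, hp, mul_one, Real.norm_of_nonneg hr.le, inv_smul_smul₀ hr.ne']

theorem radial_coe (p : S3) : radial (p : E4) = p := by
  simpa using radial_smul one_pos p

theorem contMDiffAt_radial {x : E4} (hx : x ≠ 0) :
    ContMDiffAt 𝓘(ℝ, E4) (𝓡 3) ∞ radial x := by
  apply contMDiffAt_S3_of_coe
  have h : ContDiffAt ℝ ∞ (fun y : E4 => ‖y‖⁻¹ • y) x :=
    ((contDiffAt_norm ℝ hx).inv (norm_ne_zero_iff.2 hx)).smul contDiffAt_id
  refine h.congr_of_eventuallyEq ?_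
  filter_upwards [isOpen_ne.mem_nhds hx] with y hy using coe_radial hy

theorem mdifferentiableAt_coe_S3 (p : S3) :
    MDifferentiableAt (𝓡 3) 𝓘(ℝ, E4) (fun x : S3 => (x : E4)) p :=
  (contMDiff_coe_sphere (m := 1) p).mdifferentiableAt one_ne_zero

/-! ### Isometries of the sphere are linear. -/

/-- The positively homogeneous extension to `ℝ⁴` of a self-map of the 3-sphere. -/
noncomputable def coneExt (f : S3 → S3) (x : E4) : E4 := ‖x‖ • (f (radial x) : E4)

@[simp] theorem coneExt_zero (f : S3 → S3) : coneExt f 0 = 0 := by simp [coneExt]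

theorem coneExt_coe (f : S3 → S3) (p : S3) : coneExt f p = f p := by
  simp [coneExt, radial_coe]

theorem norm_coneExt (f : S3 → S3) (x : E4) : ‖coneExt f x‖ = ‖x‖ := by
  simp [coneExt, norm_smul]

theorem coneExt_coneExt (f g : S3 → S3) (x : E4) : coneExt g (coneExt f x) = coneExt (g ∘ f) x := by
  by_cases h : x = 0
  · simp [h]
  · rw [coneExt, norm_coneExt, coneExt, radial_smul (norm_pos_iff.2 h)]
    rfl

theorem coneExt_id (x : E4) : coneExt id x = x := norm_smul_radial x

/-- The squared norm of the derivative of `y ↦ ‖y‖ g(y)` when `g` takes values in the sphere. -/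
theorem norm_sq_fderiv_norm_smul {g : E4 → E4} {x : E4} (hx : x ≠ 0) (hg : DifferentiableAt ℝ g x)
    (h1 : ∀ y, ‖g y‖ = 1) (v : E4) :
    ‖fderiv ℝ (fun y => ‖y‖ • g y) x v‖ ^ 2 =
      (fderiv ℝ (fun y : E4 => ‖y‖) x v) ^ 2 + ‖x‖ ^ 2 * ‖fderiv ℝ g x v‖ ^ 2 := by
  have hn : DifferentiableAt ℝ (fun y : E4 => ‖y‖) x := differentiableAt_id.norm ℝ hx
  -- Constant norm makes the derivative of `g` orthogonal to `g`, which kills the cross term.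
  have horth : ⟪g x, fderiv ℝ g x v⟫ = 0 := by
    have hc : (fun y => ⟪g y, g y⟫) = fun _ => (1 : ℝ) := by
      funext y
      rw [real_inner_self_eq_norm_sq, h1, one_pow]
    have h2 := fderiv_inner_apply ℝ hg hg v
    rw [hc] at h2
    simp only [fderiv_fun_const, Pi.zero_apply, zero_apply,
      real_inner_comm (g x)] at h2
    linarith
  rw [fderiv_fun_smul hn hg]
  simp only [add_apply, smul_apply,
    ContinuousLinearMap.smulRight_apply]
  rw [norm_add_sq_real, inner_smul_left, inner_smul_right, real_inner_comm, horth, norm_smul,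
    norm_smul, h1, norm_norm, Real.norm_eq_abs]
  simp [mul_pow, add_comm]

theorem hasMFDerivAt_coe_comp_radial (f : S3 ≃ₘ⟮𝓡 3, 𝓡 3⟯ S3) {x : E4} (hx : x ≠ 0) :
    HasMFDerivAt 𝓘(ℝ, E4) 𝓘(ℝ, E4) (fun y : E4 => (f (radial y) : E4)) x
      ((inclDeriv (f (radial x))).comp ((mfderiv (𝓡 3) (𝓡 3) f (radial x)).comp
        (mfderiv 𝓘(ℝ, E4) (𝓡 3) radial x))) := by
  have h1 := ((contMDiffAt_radial hx).mdifferentiableAt (by simp)).hasMFDerivAt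
  have h2 := (f.contMDiff.contMDiffAt.mdifferentiableAt (x := radial x) (by simp)).hasMFDerivAt
  have h3 := (mdifferentiableAt_coe_S3 (f (radial x))).hasMFDerivAt
  exact h3.comp x (h2.comp x h1)

theorem hasMFDerivAt_coe_radial {x : E4} (hx : x ≠ 0) :
    HasMFDerivAt 𝓘(ℝ, E4) 𝓘(ℝ, E4) (fun y : E4 => (radial y : E4)) x
      ((inclDeriv (radial x)).comp (mfderiv 𝓘(ℝ, E4) (𝓡 3) radial x)) :=
  (mdifferentiableAt_coe_S3 (radial x)).hasMFDerivAt.comp x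
    ((contMDiffAt_radial hx).mdifferentiableAt (by simp)).hasMFDerivAt

theorem differentiableAt_coneExt (f : S3 ≃ₘ⟮𝓡 3, 𝓡 3⟯ S3) {x : E4} (hx : x ≠ 0) :
    DifferentiableAt ℝ (coneExt f) x :=
  (differentiableAt_id.norm ℝ hx).smul (hasMFDerivAt_coe_comp_radial f hx).hasFDerivAt.differentiableAt

theorem IsSphereIsometry.norm_mfderiv {f : S3 ≃ₘ⟮𝓡 3, 𝓡 3⟯ S3} (hf : IsSphereIsometry f)
    (p : S3) (X : TangentSpace (𝓡 3) p) :
    ‖inclDeriv (f p) (mfderiv (𝓡 3) (𝓡 3) f p X)‖ = ‖inclDeriv p X‖ := by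
  have h := hf p X X
  simp only [roundMetric, real_inner_self_eq_norm_sq] at h
  exact (sq_eq_sq₀ (norm_nonneg _) (norm_nonneg _)).1 h

/-- The identity is the extension of the identity of the sphere. Split into radial and spherical
parts, both extensions have the same radial part, and the spherical parts have equal norms because
`f` is an isometry. -/
theorem IsSphereIsometry.norm_fderiv_coneExt {f : S3 ≃ₘ⟮𝓡 3, 𝓡 3⟯ S3} (hf : IsSphereIsometry f)
    {x : E4} (hx : x ≠ 0) (v : E4) : ‖fderiv ℝ (coneExt f) x v‖ = ‖v‖ := by
  have hF := (hasMFDerivAt_coe_comp_radial f hx).hasFDerivAt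
  have hR := (hasMFDerivAt_coe_radial hx).hasFDerivAt
  have h1 := norm_sq_fderiv_norm_smul hx hF.differentiableAt (fun y => by simp) v
  have h2 := norm_sq_fderiv_norm_smul hx hR.differentiableAt (fun y => by simp) v
  have e1 : fderiv ℝ (fun y : E4 => (f (radial y) : E4)) x v = inclDeriv (f (radial x))
      (mfderiv (𝓡 3) (𝓡 3) f (radial x) (mfderiv 𝓘(ℝ, E4) (𝓡 3) radial x v)) := by
    rw [← mfderiv_eq_fderiv, (hasMFDerivAt_coe_comp_radial f hx).mfderiv]
    rfl
  have e2 : fderiv ℝ (fun y : E4 => (radial y : E4)) x v =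
      inclDeriv (radial x) (mfderiv 𝓘(ℝ, E4) (𝓡 3) radial x v) := by
    rw [← mfderiv_eq_fderiv, (hasMFDerivAt_coe_radial hx).mfderiv]
    rfl
  have h3 : (fun y : E4 => ‖y‖ • (radial y : E4)) = id := funext norm_smul_radial
  rw [h3, fderiv_id] at h2
  have h4 := hf.norm_mfderiv (radial x) (mfderiv 𝓘(ℝ, E4) (𝓡 3) radial x v)
  refine (sq_eq_sq₀ (norm_nonneg _) (norm_nonneg _)).1 (h1.trans (Eq.trans ?_ h2.symm))
  congr 3
  exact (congrArg norm e1).trans (h4.trans (congrArg norm e2).symm)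

/-- Mean value inequality along the segment, unless it meets `0`, where differentiability is not
available; in that case `‖y - x‖ = ‖x‖ + ‖y‖` and the triangle inequality suffices. -/
theorem IsSphereIsometry.norm_coneExt_sub_le {f : S3 ≃ₘ⟮𝓡 3, 𝓡 3⟯ S3} (hf : IsSphereIsometry f)
    (x y : E4) : ‖coneExt f y - coneExt f x‖ ≤ ‖y - x‖ := by
  by_cases h : (0 : E4) ∈ segment ℝ x y
  · have h1 := dist_add_dist_of_mem_segment h
    simp only [dist_zero_right, dist_zero_left] at h1
    calc ‖coneExt f y - coneExt f x‖ ≤ ‖coneExt f y‖ + ‖coneExt f x‖ := norm_sub_le _ _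
      _ = ‖y - x‖ := by rw [norm_coneExt, norm_coneExt, ← dist_eq_norm, dist_comm, ← h1, add_comm]
  · have hne : ∀ z ∈ segment ℝ x y, z ≠ 0 := fun z hz h0 => h (h0 ▸ hz)
    have := (convex_segment (𝕜 := ℝ) x y).norm_image_sub_le_of_norm_fderiv_le (C := 1)
      (fun z hz => differentiableAt_coneExt f (hne z hz))
      (fun z hz => ContinuousLinearMap.opNorm_le_bound _ zero_le_one
        fun v => by rw [hf.norm_fderiv_coneExt (hne z hz), one_mul])
      (left_mem_segment ℝ x y) (right_mem_segment ℝ x y)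
    simpa using this

theorem IsSphereIsometry.symm {f : S3 ≃ₘ⟮𝓡 3, 𝓡 3⟯ S3} (hf : IsSphereIsometry f) :
    IsSphereIsometry f.symm := by
  intro q X Y
  have key : ∀ Z : TangentSpace (𝓡 3) q,
      inclDeriv (f (f.symm q)) (mfderiv (𝓡 3) (𝓡 3) f (f.symm q)
        (mfderiv (𝓡 3) (𝓡 3) f.symm q Z)) = inclDeriv q Z := by
    intro Z
    have h1 := (f.symm.contMDiff.contMDiffAt.mdifferentiableAt (x := q) (by simp)).hasMFDerivAt
    have h2 := (f.contMDiff.contMDiffAt.mdifferentiableAt (x := f.symm q) (by simp)).hasMFDerivAt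
    have h3 := (mdifferentiableAt_coe_S3 (f (f.symm q))).hasMFDerivAt
    have h4 := h3.comp q (h2.comp q h1)
    have h5 := (mdifferentiableAt_coe_S3 q).hasMFDerivAt
    have h6 : (fun x : S3 => (x : E4)) ∘ f ∘ f.symm = fun x : S3 => (x : E4) := by
      funext z
      simp
    rw [h6] at h4
    exact DFunLike.congr_fun (hasMFDerivAt_unique h4 h5) Z
  have h := hf (f.symm q) (mfderiv (𝓡 3) (𝓡 3) f.symm q X) (mfderiv (𝓡 3) (𝓡 3) f.symm q Y)
  rw [← h]
  simp only [roundMetric, key]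

/-- Every isometry of the 3-sphere is the restriction of a linear isometry of `ℝ⁴`. -/
theorem IsSphereIsometry.exists_linearIsometryEquiv {f : S3 ≃ₘ⟮𝓡 3, 𝓡 3⟯ S3}
    (hf : IsSphereIsometry f) : ∃ A : E4 ≃ₗᵢ[ℝ] E4, ∀ p : S3, (f p : E4) = A p := by
  have hl : ∀ x, coneExt f.symm (coneExt f x) = x := fun x => by
    rw [coneExt_coneExt, show (f.symm ∘ f : S3 → S3) = id from funext fun p => by simp, coneExt_id]
  have hr : ∀ x, coneExt f (coneExt f.symm x) = x := fun x => by
    rw [coneExt_coneExt, show (f ∘ f.symm : S3 → S3) = id from funext fun p => by simp, coneExt_id]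
  have hi : Isometry (coneExt f) := Isometry.of_dist_eq fun x y => by
    rw [dist_eq_norm, dist_eq_norm]
    refine le_antisymm (hf.norm_coneExt_sub_le y x) ?_
    simpa only [hl] using hf.symm.norm_coneExt_sub_le (coneExt f y) (coneExt f x)
  let e : E4 ≃ᵢ E4 := ⟨⟨coneExt f, coneExt f.symm, hl, hr⟩, hi⟩
  -- Mazur–Ulam: a surjective isometry fixing `0` is linear.
  exact ⟨e.toRealLinearIsometryEquivOfMapZero (coneExt_zero f), fun p => (coneExt_coe f p).symm⟩

theorem inclDeriv_mfderiv {f : S3 ≃ₘ⟮𝓡 3, 𝓡 3⟯ S3} {A : E4 ≃ₗᵢ[ℝ] E4}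
    (hA : ∀ p : S3, (f p : E4) = A p) (p : S3) (X : TangentSpace (𝓡 3) p) :
    inclDeriv (f p) (mfderiv (𝓡 3) (𝓡 3) f p X) = A (inclDeriv p X) := by
  have h2 := (f.contMDiff.contMDiffAt.mdifferentiableAt (x := p) (by simp)).hasMFDerivAt
  have h3 := (mdifferentiableAt_coe_S3 (f p)).hasMFDerivAt.comp p h2
  have h5 := (A.toContinuousLinearEquiv.hasFDerivAt (x := (p : E4))).hasMFDerivAt.comp p
    (mdifferentiableAt_coe_S3 p).hasMFDerivAt
  have h6 : (fun x : S3 => (x : E4)) ∘ f = A.toContinuousLinearEquiv ∘ fun x : S3 => (x : E4) :=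
    funext hA
  rw [h6] at h3
  exact DFunLike.congr_fun (hasMFDerivAt_unique h3 h5) X

theorem exists_inclDeriv_eq (p : S3) {w : E4} (hw : ⟪w, (p : E4)⟫ = 0) :
    ∃ X : TangentSpace (𝓡 3) p, inclDeriv p X = w := by
  have h := range_mvfderiv_subtypeVal (n := 3) p
  have hm : w ∈ (Submodule.span ℝ {(p : E4)})ᗮ := by
    rw [Submodule.mem_orthogonal_singleton_iff_inner_left]
    exact hw
  rw [← h] at hm
  exact hm

/-! ### Tangent planes. -/

/-- A local parametrization sends straight lines to curves in `S`, so the range of its injective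
differential consists of velocities. -/
theorem two_le_finrank_tangentPlane {S : Set E4} (hS : IsRegularSurface S) {p : E4} (hp : p ∈ S) :
    2 ≤ Module.finrank ℝ (tangentPlane S p) := by
  obtain ⟨V, U, x, y, -, hpV, hU, hx, himg, hinj, -, -⟩ := hS p hp
  obtain ⟨u, hu, rfl⟩ : p ∈ x '' U := himg ▸ ⟨hp, hpV⟩
  have hxu : ContDiffAt ℝ ∞ x u := hx.contDiffAt (hU.mem_nhds hu)
  have hle : (fderiv ℝ x u).toLinearMap.range ≤ tangentPlane S (x u) := by
    rintro _ ⟨w, rfl⟩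
    have hline : ContDiffAt ℝ ∞ (fun t : ℝ => u + t • w) 0 := by fun_prop
    have hu0 : u + (0 : ℝ) • w = u := by simp
    refine Submodule.subset_span ⟨fun t => x (u + t • w), ?_, by simp, ?_, ?_⟩
    · exact ContDiffAt.comp (g := x) (0 : ℝ) (by rwa [hu0]) hline
    · have : ∀ᶠ t : ℝ in nhds 0, u + t • w ∈ U :=
        hline.continuousAt.eventually_mem (by simpa using hU.mem_nhds hu)
      filter_upwards [this] with t ht
      exact (himg ▸ mem_image_of_mem x ht : x (u + t • w) ∈ S ∩ V).1
    · have h1 : HasFDerivAt x (fderiv ℝ x u) (u + (0 : ℝ) • w) := by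
        rw [hu0]
        exact (hxu.differentiableAt (by simp)).hasFDerivAt
      have h2 : HasDerivAt (fun t : ℝ => u + t • w) w 0 := by
        simpa using ((hasDerivAt_id (0 : ℝ)).smul_const w).const_add u
      exact (h1.comp_hasDerivAt (0 : ℝ) h2).deriv
  calc 2 = Module.finrank ℝ (fderiv ℝ x u).toLinearMap.range := by
        rw [LinearMap.finrank_range_of_inj (hinj u hu)]
        simp
    _ ≤ _ := Submodule.finrank_mono hle

theorem tangentPlane_perp_position {S : Set E4} (hS : S ⊆ sphere (0 : E4) 1) {p v : E4}
    (hv : v ∈ tangentPlane S p) : ⟪p, v⟫ = 0 := by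
  suffices h : tangentPlane S p ≤ (Submodule.span ℝ {p})ᗮ from
    (Submodule.mem_orthogonal_singleton_iff_inner_right).1 (h hv)
  refine Submodule.span_le.2 ?_
  rintro _ ⟨γ, hγ, rfl, hS', rfl⟩
  rw [SetLike.mem_coe, Submodule.mem_orthogonal_singleton_iff_inner_right]
  have hd := (hγ.differentiableAt (by simp)).hasDerivAt
  have h1 := hd.inner ℝ hd
  have h2 : HasDerivAt (fun t => ⟪γ t, γ t⟫) 0 (0 : ℝ) := by
    refine (hasDerivAt_const (0 : ℝ) (1 : ℝ)).congr_of_eventuallyEq ?_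
    filter_upwards [hS'] with t ht
    have := hS ht
    rw [mem_sphere_zero_iff_norm] at this
    rw [real_inner_self_eq_norm_sq, this, one_pow]
  have h3 := h1.unique h2
  rw [real_inner_comm (γ 0)] at h3
  linarith

theorem map_mem_tangentPlane {S T : Set E4} (A : E4 ≃ₗᵢ[ℝ] E4) (hA : ∀ x ∈ S, A x ∈ T) {p v : E4}
    (hv : v ∈ tangentPlane S p) : A v ∈ tangentPlane T (A p) := by
  suffices h : tangentPlane S p ≤ (tangentPlane T (A p)).comap A.toLinearEquiv.toLinearMap from h hv
  refine Submodule.span_le.2 ?_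
  rintro _ ⟨γ, hγ, rfl, hS, rfl⟩
  refine Submodule.subset_span ⟨fun t => A (γ t), ?_, rfl, ?_, ?_⟩
  · exact A.contDiff.contDiffAt.comp (0 : ℝ) hγ
  · filter_upwards [hS] with t ht using hA _ ht
  · exact ((A.toContinuousLinearEquiv.hasFDerivAt (x := γ 0)).comp_hasDerivAt (0 : ℝ)
      (hγ.differentiableAt (by simp)).hasDerivAt).deriv

/-! ### Normals, shape operators and principal curvatures under a linear isometry. -/

namespace OrientedSurface

theorem norm_eq_one (S : OrientedSurface) {p : E4} (hp : p ∈ S.carrier) : ‖p‖ = 1 :=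
  mem_sphere_zero_iff_norm.1 (S.subset_sphere hp)

/-- The normal frame `(p, N(p))` of a surface in the 3-sphere is orthonormal. -/
theorem orthonormal_frame (S : OrientedSurface) {p : E4} (hp : p ∈ S.carrier) :
    Orthonormal ℝ ![p, S.normal p] := by
  refine ⟨fun i => ?_, fun i j hij => ?_⟩
  · fin_cases i
    · exact S.norm_eq_one hp
    · exact S.normal_unit p hp
  · have h := S.normal_tangent_sphere p hp
    have h' := h
    rw [real_inner_comm] at h'
    fin_cases i <;> fin_cases j <;> simp_all

/-- Dimension count in `ℝ⁴`: the tangent plane has dimension at least 2, and its orthogonal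
complement contains the 2-dimensional span of `p` and `N(p)`. -/
theorem finrank_tangentPlane_and_orthogonal (S : OrientedSurface) {p : E4} (hp : p ∈ S.carrier) :
    Module.finrank ℝ (tangentPlane S.carrier p) = 2 ∧
      (tangentPlane S.carrier p)ᗮ = Submodule.span ℝ {p, S.normal p} := by
  have hle : Submodule.span ℝ {p, S.normal p} ≤ (tangentPlane S.carrier p)ᗮ := by
    refine Submodule.span_le.2 ?_
    rintro w (rfl | rfl)
    · exact (Submodule.mem_orthogonal' _ _).2 fun v hv =>
        tangentPlane_perp_position S.subset_sphere hv
    · exact (Submodule.mem_orthogonal' _ _).2 (S.normal_perp p hp)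
  have h2 : Module.finrank ℝ (Submodule.span ℝ {p, S.normal p}) = 2 := by
    have := finrank_span_eq_card (S.orthonormal_frame hp).linearIndependent
    rwa [Matrix.range_cons_cons_empty, Fintype.card_fin] at this
  have h3 := Submodule.finrank_mono hle
  have h4 := Submodule.finrank_add_finrank_orthogonal (tangentPlane S.carrier p)
  have h5 : Module.finrank ℝ E4 = 4 := by simp
  have h6 := two_le_finrank_tangentPlane S.regular hp
  exact ⟨by omega, (Submodule.eq_of_le_of_finrank_le hle (by omega)).symm⟩

variable {S T : OrientedSurface} {A : E4 ≃ₗᵢ[ℝ] E4}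

/-- A linear isometry carrying `S` into `T` induces isomorphisms of the tangent planes. -/
noncomputable def tangentPlaneEquiv (hA : ∀ x ∈ S.carrier, A x ∈ T.carrier) {p : E4}
    (hp : p ∈ S.carrier) : tangentPlane S.carrier p ≃ₗ[ℝ] tangentPlane T.carrier (A p) :=
  LinearEquiv.ofInjectiveOfFinrankEq
    (A.toLinearEquiv.toLinearMap.restrict fun _ hv => map_mem_tangentPlane A hA hv)
    (fun _ _ h => Subtype.ext (A.injective (congrArg Subtype.val h)))
    ((S.finrank_tangentPlane_and_orthogonal hp).1.trans
      (T.finrank_tangentPlane_and_orthogonal (hA p hp)).1.symm)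

theorem coe_tangentPlaneEquiv (hA : ∀ x ∈ S.carrier, A x ∈ T.carrier) {p : E4}
    (hp : p ∈ S.carrier) (v : tangentPlane S.carrier p) :
    (tangentPlaneEquiv hA hp v : E4) = A v := rfl

/-- Uses that `A` maps the tangent plane onto, not merely into, that of `T`. -/
theorem map_normal_mem_orthogonal (hA : ∀ x ∈ S.carrier, A x ∈ T.carrier) {p w : E4}
    (hp : p ∈ S.carrier) (hw : w ∈ (tangentPlane S.carrier p)ᗮ) :
    A w ∈ (tangentPlane T.carrier (A p))ᗮ := by
  rw [Submodule.mem_orthogonal] at hw ⊢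
  intro u hu
  obtain ⟨v, hv⟩ := (tangentPlaneEquiv hA hp).surjective ⟨u, hu⟩
  have : A v = u := congrArg Subtype.val hv
  rw [← this, A.inner_map_map]
  exact hw v v.2

theorem map_normal_eq_inner_smul (hA : ∀ x ∈ S.carrier, A x ∈ T.carrier) {p : E4}
    (hp : p ∈ S.carrier) :
    A (S.normal p) = ⟪A (S.normal p), T.normal (A p)⟫ • T.normal (A p) := by
  have h := map_normal_mem_orthogonal (w := S.normal p) hA hp
    ((Submodule.mem_orthogonal' _ _).2 (S.normal_perp p hp))
  rw [(T.finrank_tangentPlane_and_orthogonal (hA p hp)).2, Submodule.mem_span_pair] at h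
  obtain ⟨a, b, h⟩ := h
  have h0 : ⟪A (S.normal p), A p⟫ = 0 := by
    rw [A.inner_map_map, S.normal_tangent_sphere p hp]
  have h1 := T.normal_tangent_sphere _ (hA p hp)
  -- The image of the normal is orthogonal to `A p`, so it has no component along the position
  -- vector.
  have ha : a = 0 := by
    rw [← h, inner_add_left, inner_smul_left, inner_smul_left, h1, real_inner_self_eq_norm_sq,
      T.norm_eq_one (hA p hp)] at h0
    simpa using h0
  rw [← h, ha, zero_smul, zero_add, inner_smul_left, real_inner_self_eq_norm_sq,
    T.normal_unit _ (hA p hp)]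
  simp

/-- A linear isometry carrying `S` into `T` carries the unit normal of `S` to that of `T`,
up to a global sign. -/
theorem map_normal_eq_or_eq_neg (hA : ∀ x ∈ S.carrier, A x ∈ T.carrier) :
    (∀ p ∈ S.carrier, A (S.normal p) = T.normal (A p)) ∨
      ∀ p ∈ S.carrier, A (S.normal p) = -T.normal (A p) := by
  have hc : ContinuousOn (fun p => ⟪A (S.normal p), T.normal (A p)⟫) S.carrier :=
    (A.continuous.comp_continuousOn S.normal_smooth.continuousOn).inner
      (T.normal_smooth.continuousOn.comp A.continuous.continuousOn hA)
  have hsq : EqOn ((fun p => ⟪A (S.normal p), T.normal (A p)⟫) ^ 2) 1 S.carrier := by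
    intro p hp
    have h := congrArg (‖·‖) (map_normal_eq_inner_smul hA hp)
    simp only [norm_smul, A.norm_map, S.normal_unit p hp, T.normal_unit _ (hA p hp)] at h
    rw [mul_one, Real.norm_eq_abs] at h
    simp only [Pi.pow_apply, Pi.one_apply]
    rw [← sq_abs, ← h, one_pow]
  rcases S.connected.isPreconnected.eq_one_or_eq_neg_one_of_sq_eq hc hsq with h | h
  · refine Or.inl fun p hp => ?_
    have := h hp
    simp only [Pi.one_apply] at this
    rw [map_normal_eq_inner_smul hA hp, this, one_smul]
  · refine Or.inr fun p hp => ?_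
    have := h hp
    simp only [Pi.neg_apply, Pi.one_apply] at this
    rw [map_normal_eq_inner_smul hA hp, this, neg_one_smul]

/-- `fderivWithin` on a surface is not unique as a linear map of `ℝ⁴`, but on velocities of curves
in the surface the chain rule determines it. It is therefore enough to compare both sides on these
generators. -/
theorem fderivWithin_normal_map {ε : ℝ} (hA : ∀ x ∈ S.carrier, A x ∈ T.carrier)
    (hN : ∀ p ∈ S.carrier, T.normal (A p) = ε • A (S.normal p)) {p v : E4} (hp : p ∈ S.carrier)
    (hv : v ∈ tangentPlane S.carrier p) :
    fderivWithin ℝ T.normal T.carrier (A p) (A v) =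
      ε • A (fderivWithin ℝ S.normal S.carrier p v) := by
  suffices h : tangentPlane S.carrier p ≤ LinearMap.eqLocus
      ((fderivWithin ℝ T.normal T.carrier (A p)).toLinearMap ∘ₗ A.toLinearEquiv.toLinearMap)
      (ε • (A.toLinearEquiv.toLinearMap ∘ₗ (fderivWithin ℝ S.normal S.carrier p).toLinearMap)) from
    h hv
  refine Submodule.span_le.2 ?_
  rintro _ ⟨γ, hγ, rfl, hS, rfl⟩
  have hd := (hγ.differentiableAt (by simp)).hasDerivAt
  have hAd : HasDerivAt (fun t => A (γ t)) (A (deriv γ 0)) 0 :=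
    (A.toContinuousLinearEquiv.hasFDerivAt (x := γ 0)).comp_hasDerivAt (0 : ℝ) hd
  have hSN := (S.normal_smooth.differentiableOn (by simp) _ hp).hasFDerivWithinAt
  have hTN := (T.normal_smooth.differentiableOn (by simp) _ (hA _ hp)).hasFDerivWithinAt
  have h1 := (A.toContinuousLinearEquiv.hasFDerivAt.comp_hasDerivAt (0 : ℝ)
    (hSN.comp_hasDerivAt (0 : ℝ) hd hS)).const_smul ε
  have h2 := hTN.comp_hasDerivAt (0 : ℝ) hAd (hS.mono fun t ht => hA _ ht)
  refine h2.unique (h1.congr_of_eventuallyEq ?_)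
  filter_upwards [hS] with t ht using hN _ ht

theorem shapeOperator_map {ε : ℝ} (hA : ∀ x ∈ S.carrier, A x ∈ T.carrier)
    (hN : ∀ p ∈ S.carrier, T.normal (A p) = ε • A (S.normal p)) {p : E4} (hp : p ∈ S.carrier)
    (v : tangentPlane S.carrier p) :
    T.shapeOperator (A p) (tangentPlaneEquiv hA hp v) =
      ε • tangentPlaneEquiv hA hp (S.shapeOperator p v) := by
  -- `A` commutes with the orthogonal projections, since it respects both tangent and normal spaces.
  have hproj : ∀ w : E4, (tangentPlane T.carrier (A p)).orthogonalProjectionOnto (A w) =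
      tangentPlaneEquiv hA hp ((tangentPlane S.carrier p).orthogonalProjectionOnto w) := by
    intro w
    ext1
    refine Submodule.eq_starProjection_of_mem_orthogonal (Subtype.property _) ?_
    rw [coe_tangentPlaneEquiv, ← map_sub]
    exact map_normal_mem_orthogonal hA hp (Submodule.sub_starProjection_mem_orthogonal w)
  simp only [shapeOperator, LinearMap.neg_apply, LinearMap.comp_apply, Submodule.subtype_apply,
    ContinuousLinearMap.coe_coe, coe_tangentPlaneEquiv, fderivWithin_normal_map hA hN hp v.2,
    map_smul, map_neg, smul_neg, hproj]

theorem hasEigenvalue_shapeOperator_iff {ε : ℝ} (hε : ε * ε = 1)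
    (hA : ∀ x ∈ S.carrier, A x ∈ T.carrier)
    (hN : ∀ p ∈ S.carrier, T.normal (A p) = ε • A (S.normal p)) {p : E4} (hp : p ∈ S.carrier)
    (l : ℝ) : Module.End.HasEigenvalue (T.shapeOperator (A p)) l ↔
      Module.End.HasEigenvalue (S.shapeOperator p) (ε * l) := by
  set e := tangentPlaneEquiv hA hp
  constructor
  · intro h
    obtain ⟨w, hw⟩ := h.exists_hasEigenvector
    obtain ⟨v, rfl⟩ := e.surjective w
    refine Module.End.hasEigenvalue_of_hasEigenvector (x := v)
      (Module.End.hasEigenvector_iff.2 ⟨Module.End.mem_eigenspace_iff.2 (e.injective ?_), ?_⟩)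
    · have h1 := hw.apply_eq_smul
      rw [shapeOperator_map hA hN hp] at h1
      rw [map_smul, mul_smul, ← h1, smul_smul, hε, one_smul]
    · exact fun h0 => hw.2 (by rw [h0, map_zero])
  · intro h
    obtain ⟨v, hv⟩ := h.exists_hasEigenvector
    refine Module.End.hasEigenvalue_of_hasEigenvector (x := e v)
      (Module.End.hasEigenvector_iff.2 ⟨Module.End.mem_eigenspace_iff.2 ?_, ?_⟩)
    · rw [shapeOperator_map hA hN hp, hv.apply_eq_smul, map_smul, smul_smul, ← mul_assoc, hε,
        one_mul]
    · exact fun h0 => hv.2 (e.map_eq_zero_iff.1 h0)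

theorem lambda_map (hA : ∀ x ∈ S.carrier, A x ∈ T.carrier)
    (hN : ∀ p ∈ S.carrier, A (S.normal p) = T.normal (A p)) {p : E4} (hp : p ∈ S.carrier) :
    S.lambda1 p = T.lambda1 (A p) ∧ S.lambda2 p = T.lambda2 (A p) := by
  have h := hasEigenvalue_shapeOperator_iff (one_mul (1 : ℝ)) hA
    (fun p hp => by rw [hN p hp, one_smul]) hp
  simp only [lambda1, lambda2, h, one_mul, and_self]

theorem lambda_map_of_neg (hA : ∀ x ∈ S.carrier, A x ∈ T.carrier)
    (hN : ∀ p ∈ S.carrier, A (S.normal p) = -T.normal (A p)) {p : E4} (hp : p ∈ S.carrier) :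
    S.lambda1 p = -T.lambda2 (A p) ∧ S.lambda2 p = -T.lambda1 (A p) := by
  have h := hasEigenvalue_shapeOperator_iff (ε := -1) (by norm_num) hA
    (fun p hp => by rw [hN p hp, neg_one_smul, neg_neg]) hp
  have h' : {l : ℝ | Module.End.HasEigenvalue (T.shapeOperator (A p)) l} =
      -{l : ℝ | Module.End.HasEigenvalue (S.shapeOperator p) l} := by
    ext l
    simp [h]
  -- `sInf s = -sSup (-s)` holds for every real set, so neither nonemptiness nor boundedness of the
  -- spectrum is needed.
  rw [lambda1, lambda2, lambda1, lambda2, h', Real.sInf_def, Real.sInf_def, neg_neg]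
  simp

end OrientedSurface

/-! ### Translation back to the sphere and conclusion. -/

theorem carriesNormal_iff {f : S3 ≃ₘ⟮𝓡 3, 𝓡 3⟯ S3} {A : E4 ≃ₗᵢ[ℝ] E4}
    (hA : ∀ p : S3, (f p : E4) = A p) (S T : OrientedSurface) (ε : ℝ) :
    CarriesNormal f S T ε ↔ ∀ p ∈ S.carrier, A (S.normal p) = ε • T.normal (A p) := by
  constructor
  · intro h p hp
    -- A tangent vector representing the normal must exist, or `CarriesNormal` would be vacuous at
    -- `p`.
    obtain ⟨X, hX⟩ := exists_inclDeriv_eq ⟨p, S.subset_sphere hp⟩ (S.normal_tangent_sphere p hp)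
    have h1 := h ⟨p, S.subset_sphere hp⟩ hp X hX
    rwa [inclDeriv_mfderiv hA, hX, hA] at h1
  · intro h p hp X hX
    rw [inclDeriv_mfderiv hA, hX, hA, h p hp]

theorem mainTheorem2 (S T : OrientedSurface) (f : S3 ≃ₘ⟮𝓡 3, 𝓡 3⟯ S3)
    (hf : IsSphereIsometry f)
    (hfS : ∀ p : S3, (p : E4) ∈ S.carrier → (f p : E4) ∈ T.carrier) :
    (∀ p : S3, (p : E4) ∈ S.carrier → S.gaussCurvature p = T.gaussCurvature (f p)) ∧
    (CarriesNormal f S T 1 ∨ CarriesNormal f S T (-1)) ∧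
    (CarriesNormal f S T 1 → ∀ p : S3, (p : E4) ∈ S.carrier →
      S.lambda1 p = T.lambda1 (f p) ∧ S.lambda2 p = T.lambda2 (f p)) ∧
    (CarriesNormal f S T (-1) → ∀ p : S3, (p : E4) ∈ S.carrier →
      S.lambda1 p = -T.lambda2 (f p) ∧ S.lambda2 p = -T.lambda1 (f p)) := by
  obtain ⟨A, hA⟩ := hf.exists_linearIsometryEquiv
  have hAS : ∀ x ∈ S.carrier, A x ∈ T.carrier := fun x hx => by
    rw [← hA ⟨x, S.subset_sphere hx⟩]
    exact hfS _ hx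
  simp only [carriesNormal_iff hA, one_smul, neg_one_smul, hA]
  have hor := OrientedSurface.map_normal_eq_or_eq_neg hAS
  refine ⟨fun p hp => ?_, hor, fun h p hp => OrientedSurface.lambda_map hAS h hp,
    fun h p hp => OrientedSurface.lambda_map_of_neg hAS h hp⟩
  simp only [OrientedSurface.gaussCurvature]
  rcases hor with h | h
  · rw [(OrientedSurface.lambda_map hAS h hp).1, (OrientedSurface.lambda_map hAS h hp).2]
  · rw [(OrientedSurface.lambda_map_of_neg hAS h hp).1,
      (OrientedSurface.lambda_map_of_neg hAS h hp).2]
    ring
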